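/- Let $M$ be a smooth manifold (Hausdorff, second countable) and $E\to M$ a nonzero real smooth vector bundle of finite rank. For a vector bundle $V\to M$ let $\Gamma(\mathfrak D V)$ denote the $C^\infty(M)$-module of derivations of $V$, i.e. of $\mathbb R$-linear maps $\delta:\Gamma(V)\to\Gamma(V)$ together with a vector field $\alpha(\delta)$ (the anchor) such that $\delta(fu)=f\delta(u)+\alpha(\delta)(f)\,u$ for $f\in C^\infty(M)$, $u\in\Gamma(V)$; it carries the commutator bracket $[\cdot,\cdot]_{\mathfrak D}$, with anchor $[\alpha(\delta),\alpha(\delta')]$. Let $\mathfrak J E$ be the first jet bundle of $E$, regarded through the $E$-valued pairing $\langle [u]_m,\mathfrak d\rangle=(\mathfrak d u)(m)$ as $$\mathfrak J E=\{\nu\in \mathrm{Hom}(\mathfrak D E,E)\mid \nu(\Phi)=\Phi(\nu(\mathbf 1_E))\ \ \forall\,\Phi\in\mathfrak{gl}(E)\},$$ where $\mathfrak{gl}(E)=\ker\alpha$; let $\mathbb p:\mathfrak J E\to E$, $\mathbb p(\mu)=\langle\mu,\mathbf 1_E\rangle$, be the projection. For $u\in\Gamma(E)$, $\mathfrak d,\mathfrak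 r\in\Gamma(\mathfrak D E)$, $\mu\in\Gamma(\mathfrak J E)$ define $\mathbb d u,\ \mathfrak L_{\mathfrak d}\mu\in\Gamma(\mathfrak J E)$ by $\langle \mathbb d u,\mathfrak r\rangle=\mathfrak r u$ and $\langle\mathfrak L_{\mathfrak d}\mu,\mathfrak r\rangle=\mathfrak d\langle\mu,\mathfrak r\rangle-\langle\mu,[\mathfrak d,\mathfrak r]_{\mathfrak D}\rangle$. Let $\mathcal E=\mathfrak D E\oplus\mathfrak J E$ be the omni-Lie algebroid, with projection $\rho:\mathcal E\to\mathfrak D E$ and bracket $$\{\mathfrak d+\mu,\mathfrak r+\nu\}=[\mathfrak d,\mathfrak r]_{\mathfrak D}+\mathfrak L_{\mathfrak d}\nu-\mathfrak L_{\mathfrak r}\mu+\mathbb d\langle\mu,\mathfrak r\rangle$$ on $\Gamma(\mathcal E)$; let $\mathcal T=TM\oplus E$, with projection $pr_{TM}:\mathcal T\to TM$, and let $\mathbf b:\mathcal E\to\mathcal T$, $\mathbf b(\mathfrak d+\mu)=\alpha(\mathfrak d)+\mathbb p(\mu)$. Then the falling operator $$\overline{(\cdot)}:\Gamma(\mathcal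 E)\to\Gamma(\mathfrak D\mathcal T),\qquad \overline X(t)=\mathbf b\{X,Y\}\quad\text{for any } Y\in\Gamma(\mathcal E)\text{ with }\mathbf b(Y)=t,$$ is well defined: every $t\in\Gamma(\mathcal T)$ is of the form $\mathbf b(Y)$, the value does not depend on the choice of $Y$, and $\overline X$ is a derivation of $\mathcal T$ with a uniquely determined anchor. Moreover: 1. $\overline{(\cdot)}$ is a morphism of Leibniz algebras: $(\Gamma(\mathcal E),\{\cdot,\cdot\})$ and $(\Gamma(\mathfrak D\mathcal T),[\cdot,\cdot]_{\mathfrak D})$ are (left) Leibniz algebras over $\mathbb R$, and $\overline{(\cdot)}$ is $\mathbb R$-linear with $\overline{\{X,Y\}}=[\overline X,\overline Y]_{\mathfrak D}$ for all $X,Y\in\Gamma(\mathcal E)$. 2. For all $X\in\Gamma(\mathcal E)$ and $t\in\Gamma(\mathcal T)$, $$pr_{TM}(\overline X(t))=[\alpha(\rho(X)),pr_{TM}(t)]=[\alpha(\overline X),pr_{TM}(t)].$$ 3. Conversely, if $\delta\in\Gamma(\mathfrak D\mathcal T)$ satisfies $pr_{TM}(\delta(t))=[\alpha(\delta),pr_{TM}(t)]$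 for all $t\in\Gamma(\mathcal T)$, then there is $X_\delta\in\Gamma(\mathcal E)$ with $\overline{X_\delta}=\delta$. -/

import Mathlib

open Bundle VectorField
open scoped Manifold ContDiff Bundle

set_option linter.unusedSectionVars false

namespace OmniLie
noncomputable section

theorem two_le_smooth : (2 : WithTop ℕ∞) ≤ ∞ :=
  WithTop.coe_le_coe.2 (le_top : (2 : ℕ∞) ≤ ⊤)

theorem three_le_smooth : (3 : WithTop ℕ∞) ≤ ∞ :=
  WithTop.coe_le_coe.2 (le_top : (3 : ℕ∞) ≤ ⊤)

/-! ### Smooth functions, vector fields and sections -/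

section VectorFields

variable {B : Type*} [NormedAddCommGroup B] [NormedSpace ℝ B]
  {M : Type*} [TopologicalSpace M] [ChartedSpace B M]

variable (B M) in
/-- The ring `C^∞(M)` of smooth real functions on `M`. -/
abbrev Fn : Type _ := C^∞⟮𝓘(ℝ, B), M; 𝓘(ℝ, ℝ), ℝ⟯

variable (B) in
/-- `Γ(V)`: smooth sections of a vector bundle `V` over the manifold `M` (modelled on `B`). -/
abbrev Sec (F : Type*) [NormedAddCommGroup F] [NormedSpace ℝ F]
    (V : M → Type*) [TopologicalSpace (TotalSpace F V)] [∀ m, TopologicalSpace (V m)]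
    [FiberBundle F V] : Type _ :=
  ContMDiffSection 𝓘(ℝ, B) F ∞ V

section Module

variable {F : Type*} [NormedAddCommGroup F] [NormedSpace ℝ F]
  {V : M → Type*} [TopologicalSpace (TotalSpace F V)] [∀ m, TopologicalSpace (V m)]
  [∀ m, AddCommGroup (V m)] [∀ m, Module ℝ (V m)] [FiberBundle F V] [VectorBundle ℝ F V]

instance instSMulFn : SMul (Fn B M) (Sec B F V) :=
  ⟨fun f s => ⟨fun m => f m • s m, f.contMDiff.smul_section s.contMDiff⟩⟩

@[simp] theorem fsmul_apply (f : Fn B M) (s : Sec B F V) (m : M) : (f • s) m = f m • s m := rfl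

/-- `Γ(V)` is a `C^∞(M)`-module under pointwise multiplication. -/
instance instModuleFn : Module (Fn B M) (Sec B F V) where
  one_smul s := by ext m; simp
  mul_smul f g s := by ext m; simp [mul_smul]
  smul_zero f := by ext m; simp
  smul_add f s t := by ext m; simp
  add_smul f g s := by ext m; simp [add_smul]
  zero_smul s := by ext m; simp

instance instTowerFn : IsScalarTower ℝ (Fn B M) (Sec B F V) :=
  ⟨fun c f s => by ext m; simp [mul_smul]⟩

end Module

variable [IsManifold 𝓘(ℝ, B) ∞ M]

variable (B M) in
/-- `Γ(TM)`: smooth vector fields on `M`. -/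
abbrev VF : Type _ := Sec B B (TangentSpace 𝓘(ℝ, B) : M → Type _)

theorem contMDiff_dir (x : VF B M) (f : Fn B M) :
    ContMDiff 𝓘(ℝ, B) 𝓘(ℝ, ℝ) ∞ (fun m => mvfderiv 𝓘(ℝ, B) f m (x m)) := by
  have h1 : ContMDiff 𝓘(ℝ, B) 𝓘(ℝ, ℝ).tangent ∞
      (fun m => tangentMap 𝓘(ℝ, B) 𝓘(ℝ, ℝ) f ⟨m, x m⟩) :=
    (f.contMDiff.contMDiff_tangentMap (m := ∞) (by simp)).comp x.contMDiff
  intro m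
  have := (contMDiffAt_totalSpace.1 (h1 m)).2
  simpa [tangentMap, mvfderiv] using! this

/-- The derivative `x(f)` of a function `f` along a vector field `x`. -/
def dir (x : VF B M) (f : Fn B M) : Fn B M := ⟨_, contMDiff_dir x f⟩

theorem dir_apply (x : VF B M) (f : Fn B M) (m : M) :
    dir x f m = mvfderiv 𝓘(ℝ, B) f m (x m) := rfl

@[simp] theorem dir_zero_left (f : Fn B M) : dir (0 : VF B M) f = 0 := by
  ext m; simp [dir_apply]

theorem dir_add_left (x y : VF B M) (f : Fn B M) : dir (x + y) f = dir x f + dir y f := by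
  ext m; simp [dir_apply]

theorem dir_smul_left (g : Fn B M) (x : VF B M) (f : Fn B M) : dir (g • x) f = g * dir x f := by
  ext m; simp [dir_apply]

variable [FiniteDimensional ℝ B]

/-- The Lie bracket `[x, y]` of smooth vector fields. -/
def vfBracket (x y : VF B M) : VF B M :=
  ⟨mlieBracket 𝓘(ℝ, B) x y, by
    have : IsManifold 𝓘(ℝ, B) (((⊤ : ℕ∞) : WithTop ℕ∞) + 1) M := by simpa
    have : IsManifold 𝓘(ℝ, B) (minSmoothness ℝ 2) M := by
      simpa using IsManifold.of_le (n := ∞) (two_le_smooth)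
    have : CompleteSpace B := FiniteDimensional.complete ℝ B
    have : IsManifold 𝓘(ℝ, B) (minSmoothness ℝ 3) M := by
      simpa using IsManifold.of_le (n := ∞) (three_le_smooth)
    exact ContDiff.mlieBracket_vectorField (n := ⊤) (m := ⊤) x.contMDiff y.contMDiff (by simp)⟩

theorem vfBracket_apply (x y : VF B M) (m : M) :
    vfBracket x y m = mlieBracket 𝓘(ℝ, B) x y m := rfl

theorem vfBracket_add_right (x y z : VF B M) :
    vfBracket x (y + z) = vfBracket x y + vfBracket x z := by
  ext m
  have := mlieBracket_add_right (V := x) y.mdifferentiableAt (x := m) z.mdifferentiableAt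
  exact this

theorem vfBracket_swap (x y : VF B M) : vfBracket x y = - vfBracket y x := by
  ext m
  exact mlieBracket_swap_apply

theorem vfBracket_smul_right (f : Fn B M) (x y : VF B M) :
    vfBracket x (f • y) = f • vfBracket x y + dir x f • y := by
  ext m
  have := mlieBracket_smul_right (V := x) (f := f) (x := m) (f.contMDiff.mdifferentiable (by simp) m)
    y.mdifferentiableAt
  rw [add_comm] at this
  exact this

theorem vfBracket_jacobi (x y z : VF B M) :
    vfBracket x (vfBracket y z) = vfBracket (vfBracket x y) z + vfBracket y (vfBracket x z) := by
  have : CompleteSpace B := FiniteDimensional.complete ℝ B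
  have : IsManifold 𝓘(ℝ, B) (minSmoothness ℝ 3) M := by
    simpa using IsManifold.of_le (n := ∞) (three_le_smooth)
  have h (x : VF B M) (m : M) : CMDiffAt (minSmoothness ℝ 2) (fun m => (x m : TangentBundle 𝓘(ℝ, B) M)) m := by
    simpa using (x.contMDiff m).of_le (two_le_smooth)
  ext m
  exact leibniz_identity_mlieBracket_apply (h x m) (h y m) (h z m)

/-- The bracket of vector fields is the commutator of the directional derivatives. -/
theorem dir_vfBracket (x y : VF B M) (f : Fn B M) :
    dir (vfBracket x y) f = dir x (dir y f) - dir y (dir x f) := by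
  have key (w : VF B M) :
      dir (vfBracket x y) f • w = (dir x (dir y f) - dir y (dir x f)) • w := by
    have h := vfBracket_jacobi x y (f • w)
    simp only [vfBracket_smul_right, vfBracket_add_right] at h
    rw [vfBracket_jacobi x y w] at h
    rw [sub_smul]
    rw [smul_add] at h
    have h2 := sub_eq_zero.2 h.symm
    rw [← sub_eq_zero, ← h2]
    abel
  ext m
  by_cases hx : x m = 0
  · by_cases hy : y m = 0
    · by_cases hz : vfBracket x y m = 0
      · simp [dir_apply, hx, hy, hz]
      · have := congrArg (fun s : VF B M => s m) (key (vfBracket x y))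
        exact smul_left_injective ℝ hz this
    · have := congrArg (fun s : VF B M => s m) (key y)
      exact smul_left_injective ℝ hy this
  · have := congrArg (fun s : VF B M => s m) (key x)
    exact smul_left_injective ℝ hx this

end VectorFields

/-! ### The gauge Lie algebroid, the jet bundle and the omni-Lie algebroid -/

section Gauge

variable {B : Type*} [NormedAddCommGroup B] [NormedSpace ℝ B] [FiniteDimensional ℝ B]
  {M : Type*} [TopologicalSpace M] [ChartedSpace B M] [IsManifold 𝓘(ℝ, B) ∞ M]
  {F : Type*} [NormedAddCommGroup F] [NormedSpace ℝ F]
  {V : M → Type*} [TopologicalSpace (TotalSpace F V)] [∀ m, TopologicalSpace (V m)]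
  [∀ m, AddCommGroup (V m)] [∀ m, Module ℝ (V m)] [FiberBundle F V] [VectorBundle ℝ F V]

variable (B F V) in
/-- The `C^∞(M)`-module of derivations of the vector bundle `V`: pairs of an `ℝ`-linear operator
`δ` on `Γ(V)` and a vector field `x` (the anchor of `δ`) with `δ (f u) = f δ u + x(f) u`. -/
def gaugeModule : Submodule (Fn B M) (Module.End ℝ (Sec B F V) × VF B M) where
  carrier := {p | ∀ (f : Fn B M) (u : Sec B F V), p.1 (f • u) = f • p.1 u + dir p.2 f • u}
  zero_mem' := by intro f u; simp
  add_mem' := by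
    intro p q hp hq f u
    simp only [Prod.fst_add, Prod.snd_add, LinearMap.add_apply, hp f u, hq f u, dir_add_left,
      smul_add, add_smul]
    abel
  smul_mem' := by
    intro g p hp f u
    simp only [Prod.smul_fst, Prod.smul_snd, LinearMap.smul_apply, hp f u, dir_smul_left,
      smul_add, mul_smul]
    rw [smul_comm]

variable (B F V) in
/-- `Γ(𝔇V)`, the sections of the gauge Lie algebroid of `V`: the derivations of `V`. -/
abbrev GaugeSec : Type _ := gaugeModule B F V

namespace GaugeSec

/-- A derivation acts on sections: `𝔡 u`. -/
def act (d : GaugeSec B F V) : Module.End ℝ (Sec B F V) := d.1.1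

/-- The anchor `α : Γ(𝔇V) → Γ(TM)`. -/
def anchor (d : GaugeSec B F V) : VF B M := d.1.2

theorem act_smul (d : GaugeSec B F V) (f : Fn B M) (u : Sec B F V) :
    d.act (f • u) = f • d.act u + dir d.anchor f • u := d.2 f u

variable (B F V) in
/-- The identity `1_V`, as a section of `𝔤𝔩(V) ⊂ 𝔇V`. -/
def one : GaugeSec B F V := ⟨(LinearMap.id, 0), by intro f u; simp⟩

/-- The commutator bracket on `Γ(𝔇V)`. -/
def bracket (d r : GaugeSec B F V) : GaugeSec B F V :=
  ⟨(d.act ∘ₗ r.act - r.act ∘ₗ d.act, vfBracket d.anchor r.anchor), by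
    intro f u
    simp only [LinearMap.sub_apply, LinearMap.comp_apply, act_smul, map_add, dir_vfBracket,
      smul_sub, sub_smul]
    abel⟩

@[simp] theorem act_one (u : Sec B F V) : (one B F V).act u = u := rfl
@[simp] theorem anchor_one : (one B F V).anchor = 0 := rfl
@[simp] theorem act_add (d r : GaugeSec B F V) : (d + r).act = d.act + r.act := rfl
@[simp] theorem act_fsmul (f : Fn B M) (d : GaugeSec B F V) (u : Sec B F V) :
    (f • d).act u = f • d.act u := rfl
@[simp] theorem anchor_add (d r : GaugeSec B F V) : (d + r).anchor = d.anchor + r.anchor := rfl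
@[simp] theorem anchor_fsmul (f : Fn B M) (d : GaugeSec B F V) :
    (f • d).anchor = f • d.anchor := rfl
theorem act_bracket (d r : GaugeSec B F V) (u : Sec B F V) :
    (bracket d r).act u = d.act (r.act u) - r.act (d.act u) := rfl
theorem anchor_bracket (d r : GaugeSec B F V) :
    (bracket d r).anchor = vfBracket d.anchor r.anchor := rfl

theorem ext {d r : GaugeSec B F V} (h : ∀ u, d.act u = r.act u) (h' : d.anchor = r.anchor) :
    d = r :=
  Subtype.ext (Prod.ext (LinearMap.ext h) h')

theorem bracket_add_right (d r s : GaugeSec B F V) :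
    bracket d (r + s) = bracket d r + bracket d s := by
  refine ext (fun u => ?_) ?_
  · simp only [act_bracket, act_add, LinearMap.add_apply, map_add]
    abel
  · simp only [anchor_bracket, anchor_add, vfBracket_add_right]

theorem bracket_smul_right (f : Fn B M) (d r : GaugeSec B F V) :
    bracket d (f • r) = f • bracket d r + dir d.anchor f • r := by
  refine ext (fun u => ?_) ?_
  · simp only [act_bracket, act_add, LinearMap.add_apply, act_fsmul, act_smul, smul_sub]
    abel
  · simp only [anchor_bracket, anchor_add, anchor_fsmul, vfBracket_smul_right]

end GaugeSec

variable (B F V) in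
/-- The `C^∞(M)`-module of the `C^∞(M)`-linear maps `ν : Γ(𝔇V) → Γ(V)` with `ν(Φ) = Φ (ν(1_V))`
for every `Φ ∈ Γ(𝔤𝔩(V)) = ker α`. -/
def jetModule : Submodule (Fn B M) (GaugeSec B F V →ₗ[Fn B M] Sec B F V) where
  carrier := {ν | ∀ Φ : GaugeSec B F V, Φ.anchor = 0 → ν Φ = Φ.act (ν (GaugeSec.one B F V))}
  zero_mem' := by intro Φ _; simp
  add_mem' := by
    intro μ ν hμ hν Φ h
    simp only [LinearMap.add_apply, hμ Φ h, hν Φ h, map_add]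
  smul_mem' := by
    intro f μ hμ Φ h
    simp only [LinearMap.smul_apply, hμ Φ h, Φ.act_smul, h, dir_zero_left, zero_smul, add_zero]

variable (B F V) in
/-- `Γ(𝔍V)`, the sections of the first jet bundle of `V`, realised inside `Hom(𝔇V, V)` through the
`V`-valued pairing `⟨[u]_m, 𝔡⟩ = (𝔡 u)(m)` of `𝔍V` with `𝔇V`. -/
abbrev JetSec : Type _ := jetModule B F V

/-- The `V`-valued pairing `⟨μ, 𝔡⟩` of a jet and a derivation. -/
def pair (μ : JetSec B F V) (d : GaugeSec B F V) : Sec B F V := μ.1 d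

/-- The projection `𝕡 : Γ(𝔍V) → Γ(V)`, `𝕡 μ = ⟨μ, 1_V⟩`. -/
def jetProj (μ : JetSec B F V) : Sec B F V := pair μ (GaugeSec.one B F V)

/-- The jet `𝕕u` of a section `u`: `⟨𝕕u, 𝔡⟩ = 𝔡 u`. -/
def jet (u : Sec B F V) : JetSec B F V :=
  ⟨{ toFun := fun d => d.act u
     map_add' := fun _ _ => rfl
     map_smul' := fun _ _ => rfl }, fun _ _ => rfl⟩

/-- The Lie derivative on jets: `⟨𝔏_𝔡 μ, 𝔯⟩ = 𝔡⟨μ, 𝔯⟩ - ⟨μ, [𝔡, 𝔯]⟩`. -/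
def lieDer (d : GaugeSec B F V) (μ : JetSec B F V) : JetSec B F V :=
  ⟨{ toFun := fun r => d.act (pair μ r) - pair μ (d.bracket r)
     map_add' := by
      intro r s
      simp only [pair, GaugeSec.bracket_add_right, map_add]
      abel
     map_smul' := by
      intro f r
      simp only [pair, GaugeSec.bracket_smul_right, map_add, map_smul, GaugeSec.act_smul,
        smul_sub, RingHom.id_apply]
      abel }, by
    intro Φ h
    have h1 : (d.bracket Φ).anchor = 0 := by
      have : vfBracket d.anchor (0 : VF B M) = 0 := by
        simpa using vfBracket_add_right d.anchor 0 0
      rw [GaugeSec.anchor_bracket, h, this]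
    have h2 : d.bracket (GaugeSec.one B F V) = 0 := by
      refine GaugeSec.ext (fun u => ?_) ?_
      · simp [GaugeSec.act_bracket]; rfl
      · simpa [GaugeSec.anchor_bracket] using! vfBracket_add_right d.anchor 0 0
    simp only [LinearMap.coe_mk, AddHom.coe_mk, pair, h2, map_zero, sub_zero]
    rw [μ.2 Φ h, μ.2 _ h1, GaugeSec.act_bracket]
    abel⟩

variable (B F V) in
/-- `Γ(𝓔)`, the sections of the omni-Lie algebroid `𝓔 = 𝔇V ⊕ 𝔍V`. -/
abbrev OmniSec : Type _ := GaugeSec B F V × JetSec B F V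

/-- The Dorfman bracket of the omni-Lie algebroid:
`{𝔡 + μ, 𝔯 + ν} = [𝔡, 𝔯] + 𝔏_𝔡 ν - 𝔏_𝔯 μ + 𝕕⟨μ, 𝔯⟩`. -/
def dorfman (X Y : OmniSec B F V) : OmniSec B F V :=
  (X.1.bracket Y.1, lieDer X.1 Y.2 - lieDer Y.1 X.2 + jet (pair X.2 Y.1))

end Gauge

/-! ### The bundle `𝒯 = TM ⊕ E` -/

section Sum

variable {B : Type*} [NormedAddCommGroup B] [NormedSpace ℝ B]
  {M : Type*} [TopologicalSpace M] [ChartedSpace B M] [IsManifold 𝓘(ℝ, B) ∞ M]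
  {F : Type*} [NormedAddCommGroup F] [NormedSpace ℝ F]
  {V : M → Type*} [TopologicalSpace (TotalSpace F V)] [∀ m, TopologicalSpace (V m)]
  [∀ m, AddCommGroup (V m)] [∀ m, Module ℝ (V m)] [FiberBundle F V] [VectorBundle ℝ F V]

variable (B V) in
/-- The vector bundle `𝒯 = TM ⊕ V`, with model fibre `B × F`. -/
abbrev TSum : M → Type _ := (TangentSpace 𝓘(ℝ, B) : M → Type _) ×ᵇ V

/-- The projection `pr_TM : Γ(𝒯) → Γ(TM)`. -/
def prTM (t : Sec B (B × F) (TSum B V)) : VF B M :=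
  ⟨fun m => (t m).1, fun m => (contMDiffAt_section m).2
    (contMDiffAt_prod_module_iff _ |>.1 ((contMDiffAt_section m).1 (t.contMDiff m))).1⟩

/-- The section `x + v` of `𝒯` with components `x ∈ Γ(TM)` and `v ∈ Γ(V)`. -/
def mkT (x : VF B M) (v : Sec B F V) : Sec B (B × F) (TSum B V) :=
  ⟨fun m => (x m, v m), fun m => (contMDiffAt_section m).2
    (contMDiffAt_prod_module_iff _ |>.2 ⟨(contMDiffAt_section m).1 (x.contMDiff m),
      (contMDiffAt_section m).1 (v.contMDiff m)⟩)⟩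

variable [FiniteDimensional ℝ B]

/-- The map `𝐛 : Γ(𝓔) → Γ(𝒯)`, `𝐛(𝔡 + μ) = α(𝔡) + 𝕡(μ)`. -/
def bMap (X : OmniSec B F V) : Sec B (B × F) (TSum B V) := mkT X.1.anchor (jetProj X.2)

/-- `fall` is a falling operator `Γ(𝓔) → Γ(𝔇𝒯)`: `fall X` sends `t` to `𝐛{X, Y}`, for every
`Y ∈ Γ(𝓔)` with `𝐛 Y = t`. -/
def IsFalling (fall : OmniSec B F V → GaugeSec B (B × F) (TSum B V)) : Prop :=
  ∀ (X Y : OmniSec B F V) (t : Sec B (B × F) (TSum B V)),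
    bMap Y = t → (fall X).act t = bMap (dorfman X Y)

end Sum

/-! ### Leibniz algebras -/

/-- A (left) Leibniz algebra structure on a real vector space `L`: a bilinear bracket with
`[x, [y, z]] = [[x, y], z] + [y, [x, z]]`. -/
structure IsLeibnizBracket {L : Type*} [AddCommGroup L] [Module ℝ L] (br : L → L → L) :
    Prop where
  add_left : ∀ x y z, br (x + y) z = br x z + br y z
  add_right : ∀ x y z, br x (y + z) = br x y + br x z
  smul_left : ∀ (c : ℝ) x y, br (c • x) y = c • br x y
  smul_right : ∀ (c : ℝ) x y, br x (c • y) = c • br x y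
  leibniz : ∀ x y z, br x (br y z) = br (br x y) z + br y (br x z)

/-- `φ` is a morphism of Leibniz algebras from `(L, brL)` to `(L', brL')`. -/
structure IsLeibnizHom {L L' : Type*} [AddCommGroup L] [Module ℝ L] [AddCommGroup L']
    [Module ℝ L'] (brL : L → L → L) (brL' : L' → L' → L') (φ : L → L') : Prop where
  source : IsLeibnizBracket brL
  target : IsLeibnizBracket brL'
  linear : IsLinearMap ℝ φ
  map_bracket : ∀ x y, φ (brL x y) = brL' (φ x) (φ y)

end

end OmniLie

/-! The proof rests on two facts. First, a derivation of `E` with any prescribed anchor exists, by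
gluing the flat derivatives of local trivializations with a partition of unity (`exists_anchor_eq`);
hence `𝐛` is onto. Second, for `X = 𝔡 + μ` and `Y = 𝔯 + ν`, the bracket `𝐛{X, Y}` has components
`[α𝔡, α𝔯]` and `𝔡(𝕡ν) + (⟨μ, 𝔯⟩ - 𝔯(𝕡μ))` (`bMap_dorfman`). The defining condition of jets makes the
last difference depend only on `α𝔯`, so it is a tensor `Γ(TM) → Γ(E)` evaluated on `α𝔯`
(`jetTensor`). The whole expression therefore depends on `Y` only through `𝐛 Y`, and it is a
derivation in `𝐛 Y` with anchor `α𝔡`.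

The operator determines its anchor because `𝒯` contains `TM` (`anchor_eq_of_act_eq`). Compatibility
with brackets is `𝐛` applied to the Leibniz identity of the Dorfman bracket. Conversely, a
derivation `δ` of `𝒯` that acts on `TM` through its anchor is fixed by that anchor, by the
`E`-component of its restriction to `E`, which is a derivation of `E`, and by the tensor `TM → E`
that it induces. The latter two are the `𝔡` and `μ` of a preimage with `𝕡μ = 0`. -/

namespace OmniLie
noncomputable section

/-! ### Local flat derivatives and derivations with prescribed anchor. -/

section Connection

variable {B : Type*} [NormedAddCommGroup B] [NormedSpace ℝ B]
  {M : Type*} [TopologicalSpace M] [ChartedSpace B M] [IsManifold 𝓘(ℝ, B) ∞ M]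
  {F : Type*} [NormedAddCommGroup F] [NormedSpace ℝ F]
  {E : M → Type*} [TopologicalSpace (TotalSpace F E)] [∀ m, TopologicalSpace (E m)]
  [∀ m, AddCommGroup (E m)] [∀ m, Module ℝ (E m)] [FiberBundle F E] [VectorBundle ℝ F E]

/-- The function is the fibre component of the tangent map of `g` composed with the section `x`; on
the open set `U` the derivative within `U` is the full derivative. -/
theorem contMDiffOn_mvfderiv_apply (x : VF B M) {U : Set M} (hU : IsOpen U) {g : M → F}
    (hg : ContMDiffOn 𝓘(ℝ, B) 𝓘(ℝ, F) ∞ g U) :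
    ContMDiffOn 𝓘(ℝ, B) 𝓘(ℝ, F) ∞ (fun m => mvfderiv 𝓘(ℝ, B) g m (x m)) U := by
  have h1 : ContMDiffOn 𝓘(ℝ, B) 𝓘(ℝ, F).tangent ∞
      (fun m => tangentMapWithin 𝓘(ℝ, B) 𝓘(ℝ, F) g U ⟨m, x m⟩) U :=
    (hg.contMDiffOn_tangentMapWithin (m := ∞) (by simp) hU.uniqueMDiffOn).comp
      x.contMDiff.contMDiffOn (fun m hm => hm)
  intro m hm
  have h2 := (contMDiffWithinAt_totalSpace.1 (h1 m hm)).2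
  refine ContMDiffWithinAt.congr_of_eventuallyEq
    (f := fun m => mfderivWithin 𝓘(ℝ, B) 𝓘(ℝ, F) g U m (x m)) ?_ ?_ ?_
  · simpa [tangentMapWithin] using! h2
  · filter_upwards [self_mem_nhdsWithin] with m' hm'
    rw [mfderivWithin_of_isOpen hU hm']
    rfl
  · rw [mfderivWithin_of_isOpen hU hm]
    rfl

theorem mvfderiv_congr {g g' : M → F} {m : M} (h : g =ᶠ[nhds m] g') :
    mvfderiv 𝓘(ℝ, B) g m = mvfderiv 𝓘(ℝ, B) g' m := by
  ext v
  simp only [mvfderiv, ContinuousLinearMap.comp_apply]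
  rw [h.mfderiv_eq]
  rfl

theorem dir_const (x : VF B M) (c : ℝ) : dir x (ContMDiffMap.const c) = 0 := by
  ext m
  change mvfderiv 𝓘(ℝ, B) (fun _ : M => c) m (x m) = 0
  rw [mvfderiv_const]
  rfl

/-- The derivation with anchor `x` given by an additive operator satisfying the Leibniz rule. -/
def GaugeSec.ofLeibniz (D : Sec B F E → Sec B F E) (x : VF B M)
    (hadd : ∀ u v, D (u + v) = D u + D v)
    (hsmul : ∀ (f : Fn B M) u, D (f • u) = f • D u + dir x f • u) : GaugeSec B F E :=
  ⟨({ toFun := D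
      map_add' := hadd
      map_smul' := fun c u => by
        -- Real homogeneity is the Leibniz rule for a constant function, whose derivative along `x`
        -- vanishes.
        simpa [dir_const] using! hsmul (ContMDiffMap.const c) u }, x), hsmul⟩

/-- The derivative of `u` along `x` with respect to the flat connection of a trivialization. -/
def trivDeriv (e : Trivialization F (π F E)) [MemTrivializationAtlas e] (x : VF B M)
    (u : Sec B F E) (m : M) : E m :=
  e.symmL ℝ m (mvfderiv 𝓘(ℝ, B) (fun m' => (e ⟨m', u m'⟩).2) m (x m))

section

variable [ContMDiffVectorBundle ∞ F E 𝓘(ℝ, B)]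
  (e : Trivialization F (π F E)) [MemTrivializationAtlas e] (x : VF B M)

theorem contMDiffOn_triv (u : Sec B F E) :
    ContMDiffOn 𝓘(ℝ, B) 𝓘(ℝ, F) ∞ (fun m' => (e ⟨m', u m'⟩).2) e.baseSet :=
  e.contMDiffOn_section_baseSet_iff.1 u.contMDiff.contMDiffOn

theorem mdifferentiableAt_triv (u : Sec B F E) {m : M} (hm : m ∈ e.baseSet) :
    MDifferentiableAt 𝓘(ℝ, B) 𝓘(ℝ, F) (fun m' => (e ⟨m', u m'⟩).2) m :=
  ((contMDiffOn_triv e u).contMDiffAt (e.open_baseSet.mem_nhds hm)).mdifferentiableAt (by simp)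

theorem contMDiffOn_trivDeriv (u : Sec B F E) :
    ContMDiffOn 𝓘(ℝ, B) (𝓘(ℝ, B).prod 𝓘(ℝ, F)) ∞
      (fun m => TotalSpace.mk' F m (trivDeriv e x u m)) e.baseSet := by
  rw [e.contMDiffOn_section_baseSet_iff]
  refine (contMDiffOn_mvfderiv_apply x e.open_baseSet (contMDiffOn_triv e u)).congr
    fun m hm => ?_
  rw [trivDeriv, e.symmL_apply hm, e.apply_mk_symm hm]

theorem trivDeriv_add (u v : Sec B F E) {m : M} (hm : m ∈ e.baseSet) :
    trivDeriv e x (u + v) m = trivDeriv e x u m + trivDeriv e x v m := by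
  have h : (fun m' => (e ⟨m', (u + v) m'⟩).2) =ᶠ[nhds m]
      (fun m' => (e ⟨m', u m'⟩).2) + (fun m' => (e ⟨m', v m'⟩).2) := by
    filter_upwards [e.open_baseSet.mem_nhds hm] with m' hm'
    exact (e.linear ℝ hm').map_add _ _
  rw [trivDeriv, mvfderiv_congr h,
    mvfderiv_add (mdifferentiableAt_triv e u hm) (mdifferentiableAt_triv e v hm)]
  exact map_add (e.symmL ℝ m) _ _

theorem trivDeriv_smul (f : Fn B M) (u : Sec B F E) {m : M} (hm : m ∈ e.baseSet) :
    trivDeriv e x (f • u) m = f m • trivDeriv e x u m + dir x f m • u m := by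
  have h : (fun m' => (e ⟨m', (f • u) m'⟩).2) =ᶠ[nhds m]
      (f : M → ℝ) • (fun m' => (e ⟨m', u m'⟩).2) := by
    filter_upwards [e.open_baseSet.mem_nhds hm] with m' hm'
    exact (e.linear ℝ hm').map_smul _ _
  rw [trivDeriv, mvfderiv_congr h,
    mvfderiv_smul (f.contMDiff.mdifferentiableAt (by simp)) (mdifferentiableAt_triv e u hm)]
  have h' : e.symmL ℝ m (e ⟨m, u m⟩).2 = u m := by
    simp [hm]
  simp only [add_apply, smul_apply,
    ContinuousLinearMap.smulRight_apply, map_add, map_smul, h']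
  rfl

end

variable [FiniteDimensional ℝ B]

/-- If `x m ≠ 0`, a functional `l` with `l (x m) ≠ 0`, composed with the chart at `m` and cut off by
a bump function, is a global smooth `f` with `x(f)(m) = l (x m)`. -/
theorem eq_zero_of_dir_eq_zero [T2Space M] {x : VF B M} (h : ∀ f : Fn B M, dir x f = 0) : x = 0 := by
  ext m
  by_contra hx
  obtain ⟨l, hl⟩ : ∃ l : StrongDual ℝ B, l (x m) ≠ 0 :=
    SeparatingDual.exists_ne_zero (V := B) (x := x m) hx
  refine hl ?_
  let χ : SmoothBumpFunction 𝓘(ℝ, B) m := Classical.arbitrary _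
  have hs := (contMDiffOn_extChartAt (I := 𝓘(ℝ, B)) (x := m) (n := ∞))
  let f : Fn B M := ⟨_, χ.contMDiff_smul (g := fun m' => l (extChartAt 𝓘(ℝ, B) m m'))
    (l.contMDiff.comp_contMDiffOn hs)⟩
  have hf : (f : M → ℝ) =ᶠ[nhds m] l ∘ extChartAt 𝓘(ℝ, B) m := by
    filter_upwards [χ.eventuallyEq_one] with m' hm'
    change χ m' • l (extChartAt 𝓘(ℝ, B) m m') = _
    rw [hm']
    simp
  have h1 := DFunLike.congr_fun (h f) m
  rw [dir_apply, mvfderiv_congr hf, mvfderiv, mfderiv_comp m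
    l.mdifferentiableAt (mdifferentiableAt_extChartAt (mem_chart_source B m)),
    mfderiv_extChartAt_self, l.mfderiv_eq] at h1
  exact h1

variable [T2Space M] [SecondCountableTopology M] [ContMDiffVectorBundle ∞ F E 𝓘(ℝ, B)]

variable (F E) in
/-- Every vector field is the anchor of a derivation. -/
theorem exists_anchor_eq (x : VF B M) : ∃ d : GaugeSec B F E, d.anchor = x := by
  have : LocallyCompactSpace M := ChartedSpace.locallyCompactSpace B M
  obtain ⟨ρ, hρ⟩ := SmoothPartitionOfUnity.exists_isSubordinate 𝓘(ℝ, B) (isClosed_univ (X := M))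
    (fun i : M => (trivializationAt F E i).baseSet) (fun i => (trivializationAt F E i).open_baseSet)
    (fun m _ => Set.mem_iUnion_of_mem m (mem_baseSet_trivializationAt F E m))
  -- The rules for `trivDeriv` hold only on the base set; elsewhere the weight `ρ i` vanishes, so
  -- its values there do not matter.
  have hmem {i m : M} (h : ρ i m ≠ 0) : m ∈ (trivializationAt F E i).baseSet :=
    hρ i (subset_closure h)
  have hfin (u : Sec B F E) (m : M) :
      (Function.support fun i => ρ i m • trivDeriv (trivializationAt F E i) x u m).Finite :=
    (ρ.locallyFinite.point_finite m).subset fun i hi => left_ne_zero_of_smul hi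
  let D (u : Sec B F E) : Sec B F E :=
    ⟨fun m => ∑ᶠ i, ρ i m • trivDeriv (trivializationAt F E i) x u m, by
      apply ContMDiff.finsum_section_of_locallyFinite
      · exact ρ.locallyFinite.subset fun i m hm => left_ne_zero_of_smul hm
      · intro i
        exact ContMDiffOn.smul_section_of_tsupport (ρ i).contMDiff.contMDiffOn
          (trivializationAt F E i).open_baseSet (hρ i) (contMDiffOn_trivDeriv _ x u)⟩
  have hD (u : Sec B F E) (m : M) :
    D u m = ∑ᶠ i, ρ i m • trivDeriv (trivializationAt F E i) x u m := rfl
  have hadd (u v : Sec B F E) : D (u + v) = D u + D v := by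
    ext m
    simp only [ContMDiffSection.coe_add, Pi.add_apply, hD]
    rw [← finsum_add_distrib (hfin u m) (hfin v m)]
    refine finsum_congr fun i => ?_
    by_cases h : ρ i m = 0
    · simp [h]
    · rw [trivDeriv_add _ _ _ _ (hmem h), smul_add]
  have hsmul (f : Fn B M) (u : Sec B F E) : D (f • u) = f • D u + dir x f • u := by
    ext m
    -- Since the weights sum to `1`, the Leibniz term spreads over the sum and the rule can be
    -- checked summand by summand.
    have h1 : dir x f m • u m = ∑ᶠ i, ρ i m • dir x f m • u m := by
      rw [← finsum_smul, ρ.sum_eq_one (Set.mem_univ m), one_smul]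
    simp only [ContMDiffSection.coe_add, Pi.add_apply, fsmul_apply, hD]
    rw [h1, smul_finsum, ← finsum_add_distrib]
    · refine finsum_congr fun i => ?_
      by_cases h : ρ i m = 0
      · simp [h]
      · rw [trivDeriv_smul _ _ _ _ (hmem h), smul_add, smul_comm]
    · exact (hfin u m).subset fun i hi => right_ne_zero_of_smul hi
    · exact (ρ.locallyFinite.point_finite m).subset fun i hi => left_ne_zero_of_smul hi
  exact ⟨.ofLeibniz D x hadd hsmul, rfl⟩

end Connection

/-! ### Algebra of derivations. -/

section Algebra

variable {B : Type*} [NormedAddCommGroup B] [NormedSpace ℝ B] [FiniteDimensional ℝ B]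
  {M : Type*} [TopologicalSpace M] [ChartedSpace B M] [IsManifold 𝓘(ℝ, B) ∞ M]
  {F : Type*} [NormedAddCommGroup F] [NormedSpace ℝ F]
  {E : M → Type*} [TopologicalSpace (TotalSpace F E)] [∀ m, TopologicalSpace (E m)]
  [∀ m, AddCommGroup (E m)] [∀ m, Module ℝ (E m)] [FiberBundle F E] [VectorBundle ℝ F E]

namespace GaugeSec

@[simp] theorem act_neg (d : GaugeSec B F E) : (-d).act = -d.act := rfl
@[simp] theorem act_sub (d r : GaugeSec B F E) : (d - r).act = d.act - r.act := rfl
@[simp] theorem act_rsmul (c : ℝ) (d : GaugeSec B F E) : (c • d).act = c • d.act := rfl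
@[simp] theorem anchor_neg (d : GaugeSec B F E) : (-d).anchor = -d.anchor := rfl
@[simp] theorem anchor_sub (d r : GaugeSec B F E) : (d - r).anchor = d.anchor - r.anchor := rfl

theorem bracket_swap (d r : GaugeSec B F E) : d.bracket r = -r.bracket d := by
  refine ext (fun u => ?_) ?_
  · simp [act_bracket]
  · simp only [anchor_bracket, anchor_neg]
    exact vfBracket_swap _ _

theorem const_smul (c : ℝ) (d : GaugeSec B F E) :
    (ContMDiffMap.const c : Fn B M) • d = c • d := rfl

theorem bracket_rsmul_right (c : ℝ) (d r : GaugeSec B F E) :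
    d.bracket (c • r) = c • d.bracket r := by
  rw [← const_smul, bracket_smul_right, dir_const, zero_smul, add_zero, const_smul]

theorem bracket_jacobi (a b c : GaugeSec B F E) :
    a.bracket (b.bracket c) = (a.bracket b).bracket c + b.bracket (a.bracket c) := by
  refine ext (fun u => ?_) ?_
  · simp only [act_bracket, act_add, LinearMap.add_apply, map_sub]
    abel
  · simp only [anchor_bracket, anchor_add]
    exact vfBracket_jacobi _ _ _

theorem bracket_bracket (a b c : GaugeSec B F E) :
    (a.bracket b).bracket c = a.bracket (b.bracket c) - b.bracket (a.bracket c) := by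
  rw [bracket_jacobi a b c]
  abel

theorem isLeibnizBracket :
    IsLeibnizBracket (bracket : GaugeSec B F E → GaugeSec B F E → GaugeSec B F E) where
  add_left x y z := by
    rw [bracket_swap, bracket_add_right, bracket_swap x, bracket_swap y]
    abel
  add_right := bracket_add_right
  smul_left c x y := by rw [bracket_swap, bracket_rsmul_right, bracket_swap x, smul_neg]
  smul_right c x y := bracket_rsmul_right c x y
  leibniz := bracket_jacobi

-- Pairing a Lie derivative with `1_E` thus loses its bracket term: `𝕡(𝔏_𝔡 μ) = 𝔡(𝕡 μ)`.
@[simp] theorem bracket_one (d : GaugeSec B F E) : d.bracket (one B F E) = 0 := by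
  refine ext (fun u => ?_) ?_
  · simp [act_bracket]; rfl
  · simpa [anchor_bracket] using! vfBracket_add_right d.anchor 0 0

end GaugeSec

/-! ### Jets and the Leibniz identity of the Dorfman bracket. -/

theorem JetSec.ext {μ ν : JetSec B F E} (h : ∀ r, pair μ r = pair ν r) : μ = ν :=
  Subtype.ext (LinearMap.ext h)

@[simp] theorem pair_add_left (μ ν : JetSec B F E) (r : GaugeSec B F E) :
    pair (μ + ν) r = pair μ r + pair ν r := rfl
@[simp] theorem pair_sub_left (μ ν : JetSec B F E) (r : GaugeSec B F E) :
    pair (μ - ν) r = pair μ r - pair ν r := rfl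
@[simp] theorem pair_smul_left (c : ℝ) (μ : JetSec B F E) (r : GaugeSec B F E) :
    pair (c • μ) r = c • pair μ r := rfl
@[simp] theorem pair_add_right (μ : JetSec B F E) (r s : GaugeSec B F E) :
    pair μ (r + s) = pair μ r + pair μ s := map_add μ.1 r s
@[simp] theorem pair_sub_right (μ : JetSec B F E) (r s : GaugeSec B F E) :
    pair μ (r - s) = pair μ r - pair μ s := map_sub μ.1 r s
@[simp] theorem pair_fsmul_right (f : Fn B M) (μ : JetSec B F E) (r : GaugeSec B F E) :
    pair μ (f • r) = f • pair μ r := map_smul μ.1 f r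
@[simp] theorem pair_smul_right (c : ℝ) (μ : JetSec B F E) (r : GaugeSec B F E) :
    pair μ (c • r) = c • pair μ r := map_smul μ.1 (ContMDiffMap.const c) r
@[simp] theorem pair_zero_right (μ : JetSec B F E) : pair μ 0 = 0 := map_zero μ.1
@[simp] theorem pair_lieDer (d r : GaugeSec B F E) (μ : JetSec B F E) :
    pair (lieDer d μ) r = d.act (pair μ r) - pair μ (d.bracket r) := rfl
@[simp] theorem pair_jet (u : Sec B F E) (r : GaugeSec B F E) : pair (jet u) r = r.act u := rfl

theorem pair_of_anchor_eq_zero (μ : JetSec B F E) {r : GaugeSec B F E} (h : r.anchor = 0) :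
    pair μ r = r.act (jetProj μ) := μ.2 r h

theorem dorfman_isLeibnizBracket :
    IsLeibnizBracket (dorfman : OmniSec B F E → OmniSec B F E → OmniSec B F E) where
  add_left x y z := by
    refine Prod.ext (GaugeSec.isLeibnizBracket.add_left _ _ _) (JetSec.ext fun r => ?_)
    simp only [dorfman, Prod.fst_add, Prod.snd_add, pair_add_left, pair_sub_left, pair_lieDer,
      pair_jet, GaugeSec.isLeibnizBracket.add_left, GaugeSec.act_add, LinearMap.add_apply,
      map_add, pair_add_right]
    abel
  add_right x y z := by
    refine Prod.ext (GaugeSec.isLeibnizBracket.add_right _ _ _) (JetSec.ext fun r => ?_)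
    simp only [dorfman, Prod.fst_add, Prod.snd_add, pair_add_left, pair_sub_left, pair_lieDer,
      pair_jet, GaugeSec.isLeibnizBracket.add_left, GaugeSec.act_add, LinearMap.add_apply,
      map_add, pair_add_right]
    abel
  smul_left c x y := by
    refine Prod.ext (GaugeSec.isLeibnizBracket.smul_left _ _ _) (JetSec.ext fun r => ?_)
    simp only [dorfman, Prod.smul_fst, Prod.smul_snd, pair_add_left, pair_sub_left, pair_lieDer,
      pair_jet, GaugeSec.isLeibnizBracket.smul_left, GaugeSec.act_rsmul, LinearMap.smul_apply,
      map_smul, pair_smul_right, pair_smul_left, smul_add, smul_sub]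
  smul_right c x y := by
    refine Prod.ext (GaugeSec.isLeibnizBracket.smul_right _ _ _) (JetSec.ext fun r => ?_)
    simp only [dorfman, Prod.smul_fst, Prod.smul_snd, pair_add_left, pair_sub_left, pair_lieDer,
      pair_jet, GaugeSec.isLeibnizBracket.smul_left, GaugeSec.act_rsmul, LinearMap.smul_apply,
      map_smul, pair_smul_right, pair_smul_left, smul_add, smul_sub]
  leibniz x y z := by
    refine Prod.ext (GaugeSec.bracket_jacobi _ _ _) (JetSec.ext fun r => ?_)
    -- Once `bracket_bracket` has nested all brackets to the right, both sides are the same signed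
    -- sum of pairings and actions.
    simp only [dorfman, Prod.snd_add, pair_add_left, pair_sub_left, pair_lieDer,
      pair_jet, GaugeSec.bracket_bracket, GaugeSec.act_bracket, map_add, map_sub, pair_sub_right]
    abel

/-! ### Sections of `TM ⊕ E` -/

/-- The projection `Γ(TM ⊕ E) → Γ(E)`. -/
def prE (t : Sec B (B × F) (TSum B E)) : Sec B F E :=
  ⟨fun m => (t m).2, fun m => (contMDiffAt_section m).2
    (contMDiffAt_prod_module_iff _ |>.1 ((contMDiffAt_section m).1 (t.contMDiff m))).2⟩

@[simp] theorem prTM_mkT (x : VF B M) (v : Sec B F E) : prTM (mkT x v) = x := rfl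
@[simp] theorem prE_mkT (x : VF B M) (v : Sec B F E) : prE (mkT x v) = v := rfl
@[simp] theorem mkT_pr (t : Sec B (B × F) (TSum B E)) : mkT (prTM t) (prE t) = t := rfl
@[simp] theorem prTM_add (t t' : Sec B (B × F) (TSum B E)) :
    prTM (t + t') = prTM t + prTM t' := rfl
@[simp] theorem prE_add (t t' : Sec B (B × F) (TSum B E)) : prE (t + t') = prE t + prE t' := rfl
@[simp] theorem prTM_smul (f : Fn B M) (t : Sec B (B × F) (TSum B E)) :
    prTM (f • t) = f • prTM t := rfl
@[simp] theorem prE_smul (f : Fn B M) (t : Sec B (B × F) (TSum B E)) :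
    prE (f • t) = f • prE t := rfl
theorem mkT_add (x y : VF B M) (u v : Sec B F E) :
    mkT (x + y) (u + v) = mkT x u + mkT y v := rfl
theorem mkT_smul (f : Fn B M) (x : VF B M) (u : Sec B F E) :
    mkT (f • x) (f • u) = f • mkT x u := rfl

theorem sec_ext {t t' : Sec B (B × F) (TSum B E)} (h : prTM t = prTM t') (h' : prE t = prE t') :
    t = t' := by
  rw [← mkT_pr t, h, h', mkT_pr]

/-- Let `w` be the difference of the anchors. The Leibniz rules give `w(f) t = 0` for every `t`;
taking `t = w + 0` yields `w(f) w = 0`. At each point either `w(f)` or `w` vanishes, and in both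
cases `w(f)` does, so `w = 0`. -/
theorem anchor_eq_of_act_eq [T2Space M] {d r : GaugeSec B (B × F) (TSum B E)}
    (h : ∀ t, d.act t = r.act t) : d.anchor = r.anchor := by
  have key (f : Fn B M) (t : Sec B (B × F) (TSum B E)) :
      dir d.anchor f • t = dir r.anchor f • t := by
    have := h (f • t)
    rw [d.act_smul, r.act_smul, h t] at this
    exact add_left_cancel this
  rw [← sub_eq_zero]
  refine eq_zero_of_dir_eq_zero fun f => ?_
  have h0 : dir (d.anchor - r.anchor) f • (d.anchor - r.anchor) = 0 := by
    have h1 : dir (d.anchor - r.anchor) f = dir d.anchor f - dir r.anchor f := by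
      ext m
      simp [dir_apply]
    have := congrArg prTM (key f (mkT (d.anchor - r.anchor) 0))
    rw [prTM_smul, prTM_smul, prTM_mkT] at this
    rw [h1, sub_smul, this, sub_self]
  ext m
  rcases smul_eq_zero.1 (DFunLike.congr_fun h0 m) with h | h
  · exact h
  · rw [dir_apply, h, map_zero]
    rfl

/-! ### The map `𝐛` and the falling operator. -/

theorem bMap_add (X Y : OmniSec B F E) : bMap (X + Y) = bMap X + bMap Y := rfl
theorem bMap_sub (X Y : OmniSec B F E) : bMap (X - Y) = bMap X - bMap Y := rfl
theorem bMap_smul (c : ℝ) (X : OmniSec B F E) : bMap (c • X) = c • bMap X := rfl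

theorem bMap_dorfman (X Y : OmniSec B F E) :
    bMap (dorfman X Y) = mkT (vfBracket X.1.anchor Y.1.anchor)
      (X.1.act (jetProj Y.2) + (pair X.2 Y.1 - Y.1.act (jetProj X.2))) := by
  refine sec_ext rfl ?_
  change pair (lieDer X.1 Y.2 - lieDer Y.1 X.2 + jet (pair X.2 Y.1)) (.one B F E) = _
  simp [jetProj]
  abel

/-- `⟨μ, r⟩ - r (𝕡 μ)` depends only on the anchor of `r`. -/
theorem pair_sub_act_congr (μ : JetSec B F E) {r s : GaugeSec B F E} (h : r.anchor = s.anchor) :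
    pair μ r - r.act (jetProj μ) = pair μ s - s.act (jetProj μ) := by
  -- The difference `r - s` lies in `𝔤𝔩(E)`, where the jet condition turns the pairing into the
  -- action on `𝕡 μ`.
  have := pair_of_anchor_eq_zero μ (r := r - s) (by simp [h])
  rw [pair_sub_right, GaugeSec.act_sub, LinearMap.sub_apply] at this
  rw [sub_eq_sub_iff_sub_eq_sub, this]

variable [T2Space M] [SecondCountableTopology M] [ContMDiffVectorBundle ∞ F E 𝓘(ℝ, B)]

theorem bMap_surjective (t : Sec B (B × F) (TSum B E)) : ∃ Y : OmniSec B F E, bMap Y = t := by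
  obtain ⟨d, hd⟩ := exists_anchor_eq F E (prTM t)
  exact ⟨(d, jet (prE t)), sec_ext hd rfl⟩

variable (F E) in
/-- A derivation of `E` with anchor `x`. -/
def lift (x : VF B M) : GaugeSec B F E := (exists_anchor_eq F E x).choose

@[simp] theorem anchor_lift (x : VF B M) : (lift F E x).anchor = x :=
  (exists_anchor_eq F E x).choose_spec

/-- The tensor `Γ(TM) → Γ(E)` with value `⟨μ, r⟩ - r (𝕡 μ)` at the anchor of `r`. -/
def jetTensor (μ : JetSec B F E) (x : VF B M) : Sec B F E :=
  pair μ (lift F E x) - (lift F E x).act (jetProj μ)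

/-- Any derivation with the given anchor may replace the chosen `lift`; sums and function multiples
of lifts then give the linearity of `jetTensor μ`. -/
theorem jetTensor_anchor (μ : JetSec B F E) (r : GaugeSec B F E) :
    jetTensor μ r.anchor = pair μ r - r.act (jetProj μ) :=
  pair_sub_act_congr μ (by simp)

theorem jetTensor_add (μ : JetSec B F E) (x y : VF B M) :
    jetTensor μ (x + y) = jetTensor μ x + jetTensor μ y := by
  have := jetTensor_anchor μ (lift F E x + lift F E y)
  simp only [GaugeSec.anchor_add, anchor_lift, pair_add_right, GaugeSec.act_add,
    LinearMap.add_apply] at this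
  rw [this, jetTensor, jetTensor]
  abel

theorem jetTensor_smul (μ : JetSec B F E) (f : Fn B M) (x : VF B M) :
    jetTensor μ (f • x) = f • jetTensor μ x := by
  have := jetTensor_anchor μ (f • lift F E x)
  simp only [GaugeSec.anchor_fsmul, anchor_lift, pair_fsmul_right, GaugeSec.act_fsmul] at this
  rw [this, jetTensor, smul_sub]

/-- The falling operator. -/
def falling (X : OmniSec B F E) : GaugeSec B (B × F) (TSum B E) :=
  .ofLeibniz
    -- This is `bMap_dorfman` with `prTM t` in place of the anchor of `Y` and `prE t` in place of
    -- the projection of its jet.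
    (fun t => mkT (vfBracket X.1.anchor (prTM t)) (X.1.act (prE t) + jetTensor X.2 (prTM t)))
    X.1.anchor
    (fun t t' => by
      rw [← mkT_add, prTM_add, prE_add, vfBracket_add_right, map_add, jetTensor_add]
      congr 1
      abel)
    (fun f t => by
      refine sec_ext ?_ ?_
      · simp [vfBracket_smul_right]
      · simp only [prE_mkT, prTM_smul, prE_smul, GaugeSec.act_smul, jetTensor_smul, prE_add,
          smul_add]
        abel)

theorem falling_act (X : OmniSec B F E) (t : Sec B (B × F) (TSum B E)) :
    (falling X).act t =
      mkT (vfBracket X.1.anchor (prTM t)) (X.1.act (prE t) + jetTensor X.2 (prTM t)) := rfl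

theorem falling_act_bMap (X Y : OmniSec B F E) :
    (falling X).act (bMap Y) = bMap (dorfman X Y) := by
  rw [falling_act, bMap_dorfman, ← jetTensor_anchor]
  rfl

theorem isFalling_falling : IsFalling (falling (B := B) (M := M) (F := F) (E := E)) := by
  rintro X Y _ rfl
  exact falling_act_bMap X Y

theorem IsFalling.eq_falling {fall : OmniSec B F E → GaugeSec B (B × F) (TSum B E)}
    (h : IsFalling fall) : fall = falling := by
  funext X
  have hact (t) : (fall X).act t = (falling X).act t := by
    obtain ⟨Y, rfl⟩ := bMap_surjective t
    rw [h X Y _ rfl, falling_act_bMap]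
  exact GaugeSec.ext hact (anchor_eq_of_act_eq hact)

/-- By surjectivity of `𝐛` it is enough to evaluate at `bMap Z`, where linearity and bracket
compatibility are the images under `𝐛` of the corresponding laws of `dorfman`. -/
theorem isLeibnizHom_falling :
    IsLeibnizHom dorfman GaugeSec.bracket (falling (B := B) (M := M) (F := F) (E := E)) where
  source := dorfman_isLeibnizBracket
  target := GaugeSec.isLeibnizBracket
  linear := by
    constructor
    · intro X Y
      refine GaugeSec.ext (fun t => ?_) rfl
      obtain ⟨Z, rfl⟩ := bMap_surjective t
      rw [GaugeSec.act_add, LinearMap.add_apply]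
      rw [falling_act_bMap, falling_act_bMap, falling_act_bMap,
        dorfman_isLeibnizBracket.add_left X Y Z, bMap_add]
    · intro c X
      refine GaugeSec.ext (fun t => ?_) rfl
      obtain ⟨Z, rfl⟩ := bMap_surjective t
      rw [GaugeSec.act_rsmul, LinearMap.smul_apply]
      rw [falling_act_bMap, falling_act_bMap, dorfman_isLeibnizBracket.smul_left c X Z, bMap_smul]
  map_bracket X Y := by
    refine GaugeSec.ext (fun t => ?_) rfl
    obtain ⟨Z, rfl⟩ := bMap_surjective t
    simp only [GaugeSec.act_bracket, falling_act_bMap]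
    rw [← bMap_sub, dorfman_isLeibnizBracket.leibniz X Y Z, add_sub_cancel_right]

/-- A derivation of `TM ⊕ E` that acts on `TM` through its anchor is a falling. -/
theorem exists_falling_eq (δ : GaugeSec B (B × F) (TSum B E))
    (h : ∀ t, prTM (δ.act t) = vfBracket δ.anchor (prTM t)) :
    ∃ X : OmniSec B F E, falling X = δ := by
  have hz : mkT (0 : VF B M) (0 : Sec B F E) = 0 := rfl
  -- The `E`-component of `δ` on the summand `E` of `𝒯`.
  let d : GaugeSec B F E := .ofLeibniz (fun v => prE (δ.act (mkT 0 v))) δ.anchor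
    (fun u v => by
      rw [← prE_add, ← map_add, ← mkT_add, add_zero])
    (fun f u => by
      have := δ.act_smul f (mkT 0 u)
      rw [← mkT_smul, smul_zero] at this
      rw [this]
      rfl)
  -- The `E`-component of `δ` on the summand `TM`. It sees `r` only through its anchor, so it
  -- vanishes on `𝔤𝔩(E)` and on `1_E`, and the jet condition reads `0 = Φ 0`.
  let μ : JetSec B F E :=
    ⟨{ toFun := fun r => prE (δ.act (mkT r.anchor 0))
       map_add' := fun r s => by
        rw [← prE_add, ← map_add, ← mkT_add, add_zero]; rfl
       map_smul' := fun f r => by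
        have := δ.act_smul f (mkT r.anchor (0 : Sec B F E))
        rw [← mkT_smul, smul_zero] at this
        rw [GaugeSec.anchor_fsmul, this]
        simp }, by
      intro Φ hΦ
      simp only [LinearMap.coe_mk, AddHom.coe_mk, hΦ, GaugeSec.anchor_one, hz, map_zero]
      exact (map_zero Φ.act).symm⟩
  have hμ (r : GaugeSec B F E) : pair μ r = prE (δ.act (mkT r.anchor 0)) := rfl
  have hp : jetProj μ = 0 := by
    rw [jetProj, hμ, GaugeSec.anchor_one, hz, map_zero]
    rfl
  refine ⟨(d, μ), GaugeSec.ext (fun t => sec_ext ?_ ?_) rfl⟩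
  · rw [h]
    rfl
  · rw [falling_act, prE_mkT]
    change prE (δ.act (mkT 0 (prE t))) + jetTensor μ (prTM t) = _
    -- As `𝕡 μ = 0`, the tensor of `μ` is `x ↦ prE (δ (x + 0))`; additivity of `δ` reassembles `t`
    -- from its two components.
    rw [jetTensor, hp, map_zero, sub_zero, hμ, anchor_lift, ← prE_add, ← map_add, ← mkT_add,
      zero_add, add_zero, mkT_pr]

end Algebra

end

end OmniLie

theorem proposition5p2
    {B : Type*} [NormedAddCommGroup B] [NormedSpace ℝ B] [FiniteDimensional ℝ B]
    {M : Type*} [TopologicalSpace M] [T2Space M] [SecondCountableTopology M]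
    [ChartedSpace B M] [IsManifold 𝓘(ℝ, B) ∞ M]
    {F : Type*} [NormedAddCommGroup F] [NormedSpace ℝ F] [FiniteDimensional ℝ F] [Nontrivial F]
    {E : M → Type*} [TopologicalSpace (TotalSpace F E)] [∀ m, TopologicalSpace (E m)]
    [∀ m, AddCommGroup (E m)] [∀ m, Module ℝ (E m)] [FiberBundle F E] [VectorBundle ℝ F E]
    [ContMDiffVectorBundle ∞ F E 𝓘(ℝ, B)] :
    -- every section of `𝒯 = TM ⊕ E` is of the form `𝐛 Y`
    (∀ t : OmniLie.Sec B (B × F) (OmniLie.TSum B E),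
      ∃ Y : OmniLie.OmniSec B F E, OmniLie.bMap Y = t) ∧
    -- the falling operator is well defined, and it is unique
    ∃ fall : OmniLie.OmniSec B F E → OmniLie.GaugeSec B (B × F) (OmniLie.TSum B E),
      OmniLie.IsFalling fall ∧ (∀ fall', OmniLie.IsFalling fall' → fall' = fall) ∧
      -- it is a morphism of Leibniz algebras
      OmniLie.IsLeibnizHom OmniLie.dorfman OmniLie.GaugeSec.bracket fall ∧
      -- `pr_TM (fall X t) = [α (ρ X), pr_TM t] = [α (fall X), pr_TM t]`
      (∀ (X : OmniLie.OmniSec B F E) (t : OmniLie.Sec B (B × F) (OmniLie.TSum B E)),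
        OmniLie.prTM ((fall X).act t) = OmniLie.vfBracket X.1.anchor (OmniLie.prTM t) ∧
        OmniLie.vfBracket X.1.anchor (OmniLie.prTM t) =
          OmniLie.vfBracket (fall X).anchor (OmniLie.prTM t)) ∧
      -- conversely, every derivation of `𝒯` satisfying this identity is a falling
      ∀ δ : OmniLie.GaugeSec B (B × F) (OmniLie.TSum B E),
        (∀ t : OmniLie.Sec B (B × F) (OmniLie.TSum B E),
          OmniLie.prTM (δ.act t) = OmniLie.vfBracket δ.anchor (OmniLie.prTM t)) →
        ∃ X : OmniLie.OmniSec B F E, fall X = δ := by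
  exact ⟨OmniLie.bMap_surjective, OmniLie.falling, OmniLie.isFalling_falling,
    fun _ h => h.eq_falling, OmniLie.isLeibnizHom_falling, fun _ _ => ⟨rfl, rfl⟩,
    OmniLie.exists_falling_eq⟩
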